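/- Let $\gamma\ge 1$, let $s=(1,1,\gamma)$, and for $x\ne y$ in $\mathbb R^3$ let $$g(x,y)=\frac{x-y}{\bigl((x_1-y_1)^2+(x_2-y_2)^2+\gamma^2(x_3-y_3)^2\bigr)^{3/2}}\in\mathbb R^3 .$$ For nonempty compact sets $S,T\subset\mathbb R^3$ (for instance finite sets of particle positions) put $$\operatorname{diam}_s(S)=\max_{x,y\in S}\|s\circ(x-y)\|_2,\qquad \operatorname{dist}_s(S,T)=\min_{x\in S,\,y\in T}\|s\circ(x-y)\|_2,$$ where $\circ$ is the componentwise product, and let $Q(S)=\prod_{k=1}^3[\min_{x\in S}x_k,\max_{x\in S}x_k]$ be the bounding box of $S$. Let $S_t,S_s$ be nonempty compact sets with bounding boxes $Q_t,Q_s$. Let $n\ge 0$, and on each side of $Q_t$ and of $Q_s$ let $n+1$ distinct interpolation nodes be given, with Lagrange basis polynomials $\ell_0,\dots,\ell_n$ such that $\sum_i|\ell_i|\le\Lambda$ on that side (the Lebesgue constant is at most $\Lambda$). Let $\xi_{t,\mu},\xi_{s,\nu}$ ($\mu,\nu\in\{0,\dots,n\}^3$) be the resulting tensor grid points, $\ell_{t,\mu},\ell_{s,\nu}$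 the products of the three univariate basis polynomials, and $$\tilde g(x,y)=\sum_{\mu}\sum_{\nu}\ell_{t,\mu}(x)\,g(\xi_{t,\mu},\xi_{s,\nu})\,\ell_{s,\nu}(y).$$ Write $\delta=\max(\operatorname{diam}_s(S_t),\operatorname{diam}_s(S_s))$ and $\|g-\tilde g\|_{\infty,Q_t\times Q_s}=\sup_{x\in Q_t,\,y\in Q_s}\max_k|g_k(x,y)-\tilde g_k(x,y)|$. (a) There is a constant $C>0$ depending only on $n$ and $\Lambda$ (not on $\gamma$, the sets or the nodes) such that, whenever $d=\operatorname{dist}_s(Q_t,Q_s)>0$, $$\|g-\tilde g\|_{\infty,Q_t\times Q_s}\le\frac{C}{d^2}\Bigl(\frac{\delta}{d}\Bigr)^{n+1}.$$ In particular, if $\delta/d<\eta$ for some $\eta>0$, the error is at most $C\,d^{-2}\,\eta^{n+1}$. (b) For every $\eta$ with $0<\eta<1/\sqrt6$ there is a constant $C>0$ depending only on $n$, $\Lambda$ and $\eta$ such that, whenever $d=\operatorname{dist}_s(S_t,S_s)>0$ and the admissibility condition $\delta/d<\eta$ holds, $$\|g-\tilde g\|_{\infty,Q_t\times Q_s}\le\frac{C}{d^2}\Bigl(\frac{\delta}{d}\Bigr)^{n+1}\le\frac{C}{d^2}\,\eta^{n+1}.$$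 -/

import Mathlib

noncomputable section

namespace RelativisticFMM

/-- The stretch vector `(1, 1, γ)`. -/
def stretch (γ : ℝ) : Fin 3 → ℝ := ![1, 1, γ]

/-- The stretched Euclidean distance `‖s ∘ (x - y)‖₂` of two points of `ℝ³`. -/
def stretchedNorm (s x y : Fin 3 → ℝ) : ℝ :=
  ‖WithLp.toLp 2 (fun k => s k * (x k - y k))‖

/-- The stretched diameter of a set: the supremum (a maximum when the set is compact and nonempty)
of the stretched distances between two of its points. -/
def stretchedDiam (s : Fin 3 → ℝ) (S : Set (Fin 3 → ℝ)) : ℝ :=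
  sSup {r | ∃ x ∈ S, ∃ y ∈ S, r = stretchedNorm s x y}

/-- The stretched distance of two sets: the infimum (a minimum when both are compact and nonempty)
of the stretched distances between a point of the first and a point of the second. -/
def stretchedDist (s : Fin 3 → ℝ) (S T : Set (Fin 3 → ℝ)) : ℝ :=
  sInf {r | ∃ x ∈ S, ∃ y ∈ T, r = stretchedNorm s x y}

/-- The axis-parallel bounding box `[a₁, b₁] × [a₂, b₂] × [a₃, b₃]` of a set, where `a k` and `b k`
are the smallest and the largest value of the `k`-th coordinate on the set. -/
def boundingBox (S : Set (Fin 3 → ℝ)) : Set (Fin 3 → ℝ) :=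
  Set.Icc (fun k => sInf ((fun x : Fin 3 → ℝ => x k) '' S))
    (fun k => sSup ((fun x : Fin 3 → ℝ => x k) '' S))

/-- The relativistic kernel
`g(x, y) = (x - y) / ((x₁ - y₁)² + (x₂ - y₂)² + γ² (x₃ - y₃)²) ^ (3/2)`, with values in `ℝ³`. -/
def kernel (γ : ℝ) (x y : Fin 3 → ℝ) : Fin 3 → ℝ := fun k =>
  (x k - y k) /
    ((x 0 - y 0) ^ 2 + (x 1 - y 1) ^ 2 + γ ^ 2 * (x 2 - y 2) ^ 2) ^ ((3 : ℝ) / 2)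

/-- The point `(ξ_{1, μ₁}, ξ_{2, μ₂}, ξ_{3, μ₃})` of the tensor grid with axis nodes `ξ`. -/
def gridPoint {n : ℕ} (ξ : Fin 3 → Fin (n + 1) → ℝ) (μ : Fin 3 → Fin (n + 1)) : Fin 3 → ℝ :=
  fun k => ξ k (μ k)

/-- The univariate Lagrange basis polynomial of degree `n` for the nodes `ξ 0, …, ξ n` that
belongs to the `i`-th node, evaluated at `t`. -/
def lagrange {n : ℕ} (ξ : Fin (n + 1) → ℝ) (i : Fin (n + 1)) (t : ℝ) : ℝ :=
  (Lagrange.basis Finset.univ ξ i).eval t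

/-- The tensor-product Lagrange basis polynomial
`ℓ_μ(x) = ℓ_{1, μ₁}(x₁) ℓ_{2, μ₂}(x₂) ℓ_{3, μ₃}(x₃)`. -/
def tensorLagrange {n : ℕ} (ξ : Fin 3 → Fin (n + 1) → ℝ) (μ : Fin 3 → Fin (n + 1))
    (x : Fin 3 → ℝ) : ℝ :=
  ∏ k, lagrange (ξ k) (μ k) (x k)

/-- The tensor-product interpolant of `G` in both variables:
`∑ μ, ∑ ν, ℓ_{t, μ}(x) G(ξ_{t, μ}, ξ_{s, ν}) ℓ_{s, ν}(y)`. -/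
def interpolant {n : ℕ} (ξt ξs : Fin 3 → Fin (n + 1) → ℝ)
    (G : (Fin 3 → ℝ) → (Fin 3 → ℝ) → (Fin 3 → ℝ)) (x y : Fin 3 → ℝ) : Fin 3 → ℝ :=
  ∑ μ : Fin 3 → Fin (n + 1), ∑ ν : Fin 3 → Fin (n + 1),
    (tensorLagrange ξt μ x * tensorLagrange ξs ν y) • G (gridPoint ξt μ) (gridPoint ξs ν)

/-- `ξ` gives the axis nodes of a tensor grid of degree `n` in `Q`: the `n + 1` nodes on each axis
are distinct and all grid points lie in `Q`. The Lebesgue constants (the suprema of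
`∑ i, |ℓ_i|` over the sides of the box `Q`) are at most `Λ`. -/
structure IsInterpolationGrid {n : ℕ} (Λ : ℝ) (Q : Set (Fin 3 → ℝ))
    (ξ : Fin 3 → Fin (n + 1) → ℝ) : Prop where
  injective : ∀ k, Function.Injective (ξ k)
  mem : ∀ μ : Fin 3 → Fin (n + 1), gridPoint ξ μ ∈ Q
  lebesgue_le : ∀ k, ∀ x ∈ Q, ∑ i, |lagrange (ξ k) i (x k)| ≤ Λ

end RelativisticFMM

end

/-!
Along a coordinate axis, every component of the kernel is a constant multiple of a radial quotient
`τ ^ i * A ^ j / r ^ (i + j + q)` with `r = √(τ² + B)`, `A² ≤ B` and `q = 2`. Such a quotient is at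
most `1 / r ^ q`, and its derivative is a combination of two quotients of the same form with `q + 1`
in place of `q`. Replacing the derivative of order `n + 1` by zero and integrating back therefore
gives a polynomial of degree `n` whose error is of order `d ^ (-2) * (δ / d) ^ (n + 1)`, with no
dependence on `γ`, because a side of the box has stretched length at most `δ`. Lagrange
interpolation multiplies this error by at most `1 + Λ`, and the interpolation operators of the six
coordinates are applied one after the other.

When only the clusters are known to be separated, a double count of squared distances shows that
each point of a bounding box lies within `√5 / 2 * δ` of the cluster, so the boxes are still at
distance at least `(1 - √5 * η) * d`.
-/

namespace RelativisticFMM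

open Polynomial

section PolynomialApproximation

lemma exists_mem_degreeLT_derivative_eq {K : Type*} [Field K] [CharZero K] {p : K[X]} {m : ℕ}
    (hp : p ∈ degreeLT K m) : ∃ P ∈ degreeLT K (m + 1), derivative P = p := by
  classical
  suffices h : degreeLT K m ≤ (degreeLT K (m + 1)).map derivative from Submodule.mem_map.1 (h hp)
  rw [degreeLT_eq_span_X_pow, Submodule.span_le, Finset.coe_image]
  rintro _ ⟨i, hi, rfl⟩
  have hi' : (i : K) + 1 ≠ 0 := Nat.cast_add_one_ne_zero i
  refine ⟨C ((i : K) + 1)⁻¹ * X ^ (i + 1), mem_degreeLT.2 ?_, ?_⟩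
  · refine (degree_C_mul_X_pow_le _ _).trans_lt ?_
    exact_mod_cast Nat.succ_lt_succ (Finset.mem_range.1 hi)
  · rw [derivative_C_mul_X_pow]
    simp [hi']

lemma comp_mem_degreeLT {R : Type*} [Semiring R] {p q : R[X]} {m : ℕ} (hp : p ∈ degreeLT R m)
    (hq : q.natDegree ≤ 1) : p.comp q ∈ degreeLT R m := by
  rcases eq_or_ne p 0 with rfl | hp0
  · simp
  rw [mem_degreeLT] at hp ⊢
  have hcomp : (p.comp q).natDegree ≤ p.natDegree :=
    natDegree_comp_le.trans ((Nat.mul_le_mul_left _ hq).trans_eq (mul_one _))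
  exact (degree_le_natDegree.trans (by exact_mod_cast hcomp)).trans_lt
    ((degree_eq_natDegree hp0).symm.trans_lt hp)

/-- `f` is within `ε` of a real polynomial of degree less than `m` on the set `A`. The strict
degree bound allows `m = 0`, where the polynomial is zero and induction on `m` starts. -/
def PolynomiallyApproximable (f : ℝ → ℝ) (A : Set ℝ) (m : ℕ) (ε : ℝ) : Prop :=
  ∃ p ∈ degreeLT ℝ m, ∀ t ∈ A, |f t - p.eval t| ≤ ε

lemma polynomiallyApproximable_zero_of_abs_le {f : ℝ → ℝ} {A : Set ℝ} {ε : ℝ}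
    (h : ∀ t ∈ A, |f t| ≤ ε) : PolynomiallyApproximable f A 0 ε :=
  ⟨0, zero_mem _, by simpa using h⟩

namespace PolynomiallyApproximable

variable {f g f' : ℝ → ℝ} {A : Set ℝ} {m : ℕ} {ε ε₁ ε₂ : ℝ}

lemma mono (hf : PolynomiallyApproximable f A m ε₁) (hε : ε₁ ≤ ε₂) :
    PolynomiallyApproximable f A m ε₂ := by
  obtain ⟨p, hp, hfp⟩ := hf
  exact ⟨p, hp, fun t ht => (hfp t ht).trans hε⟩

lemma const_mul (c : ℝ) (hf : PolynomiallyApproximable f A m ε) :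
    PolynomiallyApproximable (fun t => c * f t) A m (|c| * ε) := by
  obtain ⟨p, hp, hfp⟩ := hf
  refine ⟨c • p, Submodule.smul_mem _ c hp, fun t ht => ?_⟩
  rw [eval_smul, smul_eq_mul, ← mul_sub, abs_mul]
  gcongr
  exact hfp t ht

lemma sub (hf : PolynomiallyApproximable f A m ε₁) (hg : PolynomiallyApproximable g A m ε₂) :
    PolynomiallyApproximable (fun t => f t - g t) A m (ε₁ + ε₂) := by
  obtain ⟨p, hp, hfp⟩ := hf
  obtain ⟨q, hq, hgq⟩ := hg
  refine ⟨p - q, Submodule.sub_mem _ hp hq, fun t ht => ?_⟩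
  rw [eval_sub, sub_sub_sub_comm]
  exact (abs_sub _ _).trans (add_le_add (hfp t ht) (hgq t ht))

lemma comp_affine (hf : PolynomiallyApproximable f A m ε) (a b : ℝ) {A' : Set ℝ}
    (hA : Set.MapsTo (fun t => a * t + b) A' A) :
    PolynomiallyApproximable (fun t => f (a * t + b)) A' m ε := by
  obtain ⟨p, hp, hfp⟩ := hf
  refine ⟨p.comp (C a * X + C b), comp_mem_degreeLT hp natDegree_linear_le, fun t ht => ?_⟩
  simpa using hfp _ (hA ht)

lemma of_hasDerivWithinAt (hf' : PolynomiallyApproximable f' A m ε) (hA : Convex ℝ A)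
    (hf : ∀ t ∈ A, HasDerivWithinAt f (f' t) A t) {a W : ℝ} (ha : a ∈ A)
    (hW : ∀ t ∈ A, |t - a| ≤ W) : PolynomiallyApproximable f A (m + 1) (ε * W) := by
  obtain ⟨p, hp, hfp⟩ := hf'
  obtain ⟨P, hP, rfl⟩ := exists_mem_degreeLT_derivative_eq hp
  have hconst : C (f a - P.eval a) ∈ degreeLT ℝ (m + 1) :=
    mem_degreeLT.2 (degree_C_le.trans_lt (by exact_mod_cast m.succ_pos))
  refine ⟨P + C (f a - P.eval a), Submodule.add_mem _ hP hconst, fun t ht => ?_⟩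
  have hmean := hA.norm_image_sub_le_of_norm_hasDerivWithin_le
    (fun u hu => (hf u hu).sub (P.hasDerivWithinAt u A)) hfp ha ht
  have hε : 0 ≤ ε := (abs_nonneg _).trans (hfp a ha)
  calc |f t - (P + C (f a - P.eval a)).eval t|
      = |f t - P.eval t - (f a - P.eval a)| := by
        rw [eval_add, eval_C, sub_add_eq_sub_sub]
    _ ≤ ε * |t - a| := hmean
    _ ≤ ε * W := by
        gcongr
        exact hW t ht

end PolynomiallyApproximable

end PolynomialApproximation

section RadialQuotient

/-- The quotient `τ ^ i A ^ j / r ^ (i + j + q)` with `r = √(τ² + B)`, where `A` and `B` are fixed.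
With `A` a coordinate orthogonal to the direction of `τ`, both the component of `z / ‖z‖³` along
that direction and the one along `A` are of this form with `q = 2`. Differentiation in `τ` keeps
the form and raises `q` by one. -/
noncomputable def radialQuotient (A B : ℝ) (i j q : ℕ) (τ : ℝ) : ℝ :=
  τ ^ i * A ^ j / √(τ ^ 2 + B) ^ (i + j + q)

variable {A B : ℝ}

lemma hasDerivAt_radialQuotient (A : ℝ) (i j q : ℕ) {τ : ℝ} (h : 0 < τ ^ 2 + B) :
    HasDerivAt (radialQuotient A B i j q)
      (i * radialQuotient A B (i - 1) j (q + 1) τ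
        - (i + j + q : ℕ) * radialQuotient A B (i + 1) j (q + 1) τ) τ := by
  have hr : √(τ ^ 2 + B) ≠ 0 := (Real.sqrt_pos.2 h).ne'
  have hsqrt : HasDerivAt (fun τ => √(τ ^ 2 + B)) (τ / √(τ ^ 2 + B)) τ := by
    refine (((hasDerivAt_pow 2 τ).add_const B).sqrt h.ne').congr_deriv ?_
    field_simp
    simp
  refine (((hasDerivAt_pow i τ).mul_const (A ^ j)).div (hsqrt.pow (i + j + q))
    (pow_ne_zero _ hr)).congr_deriv ?_
  simp only [radialQuotient, Pi.pow_apply]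
  generalize √(τ ^ 2 + B) = r at *
  rcases i with _ | i
  · rcases Nat.eq_zero_or_pos (0 + j + q) with h0 | hpos
    · obtain ⟨rfl, rfl⟩ : j = 0 ∧ q = 0 := by omega
      simp
    · obtain ⟨N, hN⟩ := Nat.exists_eq_succ_of_ne_zero hpos.ne'
      rw [show 0 + 1 + j + (q + 1) = N + 3 by omega, hN]
      simp only [Nat.succ_eq_add_one, Nat.add_sub_cancel]
      field_simp
      push_cast
      ring
  · rw [show i + 1 - 1 + j + (q + 1) = i + j + q + 1 by omega,
      show i + 1 + 1 + j + (q + 1) = i + j + q + 3 by omega,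
      show i + 1 + j + q = i + j + q + 1 by omega]
    simp only [Nat.add_sub_cancel]
    push_cast
    field_simp
    ring

lemma abs_radialQuotient_le (hAB : A ^ 2 ≤ B) (i j q : ℕ) {τ ρ : ℝ} (hρ : 0 < ρ)
    (h : ρ ≤ √(τ ^ 2 + B)) : |radialQuotient A B i j q τ| ≤ 1 / ρ ^ q := by
  have hr : 0 < √(τ ^ 2 + B) := hρ.trans_le h
  have hτ : |τ| ≤ √(τ ^ 2 + B) := Real.abs_le_sqrt (by linarith [sq_nonneg A])
  have hA : |A| ≤ √(τ ^ 2 + B) := Real.abs_le_sqrt (by linarith [sq_nonneg τ])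
  rw [radialQuotient, abs_div, abs_mul, abs_pow, abs_pow, abs_of_pos (pow_pos hr _)]
  calc |τ| ^ i * |A| ^ j / √(τ ^ 2 + B) ^ (i + j + q)
      ≤ √(τ ^ 2 + B) ^ i * √(τ ^ 2 + B) ^ j / √(τ ^ 2 + B) ^ (i + j + q) := by gcongr
    _ = 1 / √(τ ^ 2 + B) ^ q := by
        rw [pow_add, pow_add]
        field_simp
    _ ≤ 1 / ρ ^ q := by gcongr

lemma polynomiallyApproximable_radialQuotient (hAB : A ^ 2 ≤ B) {I : Set ℝ} (hI : Convex ℝ I)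
    {a W ρ : ℝ} (ha : a ∈ I) (hW : ∀ τ ∈ I, |τ - a| ≤ W) (hρ : 0 < ρ)
    (hr : ∀ τ ∈ I, ρ ≤ √(τ ^ 2 + B)) {i j q m N : ℕ} (hN : 2 * i + j + q + 3 * m ≤ N) :
    PolynomiallyApproximable (radialQuotient A B i j q) I m (N ^ m * W ^ m / ρ ^ (q + m)) := by
  induction m generalizing i q with
  | zero =>
    refine polynomiallyApproximable_zero_of_abs_le fun τ hτ => ?_
    simpa using abs_radialQuotient_le hAB i j q hρ (hr τ hτ)
  | succ m ih =>
    have hW0 : 0 ≤ W := (abs_nonneg _).trans (hW a ha)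
    have hcoeff : (i : ℝ) + (i + j + q : ℕ) ≤ N := by exact_mod_cast (by omega)
    have hderiv := ((ih (i := i - 1) (q := q + 1) (by omega)).const_mul i).sub
      ((ih (i := i + 1) (q := q + 1) (by omega)).const_mul (i + j + q : ℕ))
    refine (hderiv.of_hasDerivWithinAt hI (fun τ hτ => (hasDerivAt_radialQuotient A i j q
      (Real.sqrt_pos.1 (hρ.trans_le (hr τ hτ)))).hasDerivWithinAt) ha hW).mono ?_
    rw [Nat.abs_cast, Nat.abs_cast, ← add_mul, show q + 1 + m = q + (m + 1) by ring]
    calc _ ≤ (N : ℝ) * (N ^ m * W ^ m / ρ ^ (q + (m + 1))) * W := by gcongr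
      _ = _ := by ring

end RadialQuotient

section Interpolation

lemma abs_sub_sum_mul_le {ι : Type*} [Fintype ι] {a ε₁ ε₂ Λ : ℝ} {w b c : ι → ℝ}
    (hε₂ : 0 ≤ ε₂) (hab : |a - ∑ i, w i * b i| ≤ ε₁) (hbc : ∀ i, |b i - c i| ≤ ε₂)
    (hw : ∑ i, |w i| ≤ Λ) : |a - ∑ i, w i * c i| ≤ ε₁ + Λ * ε₂ := by
  have hsum : |∑ i, w i * b i - ∑ i, w i * c i| ≤ Λ * ε₂ :=
    calc |∑ i, w i * b i - ∑ i, w i * c i| = |∑ i, w i * (b i - c i)| := by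
          simp only [mul_sub, Finset.sum_sub_distrib]
      _ ≤ ∑ i, |w i| * ε₂ := by
          refine (Finset.abs_sum_le_sum_abs _ _).trans (Finset.sum_le_sum fun i _ => ?_)
          rw [abs_mul]
          gcongr
          exact hbc i
      _ ≤ Λ * ε₂ := by
          rw [← Finset.sum_mul]
          gcongr
  exact (abs_sub_le _ _ _).trans (add_le_add hab hsum)

lemma sum_lagrange_mul_eval {n : ℕ} {ξ : Fin (n + 1) → ℝ} (hξ : Function.Injective ξ) {p : ℝ[X]}
    (hp : p ∈ degreeLT ℝ (n + 1)) (t : ℝ) : ∑ i, lagrange ξ i t * p.eval (ξ i) = p.eval t := by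
  have hinterp := Lagrange.eq_interpolate (s := Finset.univ) hξ.injOn
    (by simpa using mem_degreeLT.1 hp)
  conv_rhs => rw [hinterp]
  simp [Lagrange.interpolate_apply, eval_finsetSum, lagrange, mul_comm]

lemma PolynomiallyApproximable.abs_sub_sum_lagrange_le {n : ℕ} {f : ℝ → ℝ} {A : Set ℝ} {ε Λ : ℝ}
    (hf : PolynomiallyApproximable f A (n + 1) ε) {ξ : Fin (n + 1) → ℝ}
    (hξ : Function.Injective ξ) (hξA : ∀ i, ξ i ∈ A) {t : ℝ} (ht : t ∈ A)
    (hΛ : ∑ i, |lagrange ξ i t| ≤ Λ) :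
    |f t - ∑ i, lagrange ξ i t * f (ξ i)| ≤ (1 + Λ) * ε := by
  obtain ⟨p, hp, hfp⟩ := hf
  rw [one_add_mul]
  refine abs_sub_sum_mul_le (b := fun i => p.eval (ξ i)) ((abs_nonneg _).trans (hfp t ht)) ?_
    (fun i => ?_) hΛ
  · rw [sum_lagrange_mul_eval hξ hp]
    exact hfp t ht
  · rw [abs_sub_comm]
    exact hfp _ (hξA i)

lemma sum_prod_mul_eq_sum_mul_sum_cons {R κ : Type*} [CommSemiring R] [Fintype κ] {d : ℕ}
    (w : Fin (d + 1) → κ → R) (F : (Fin (d + 1) → κ) → R) :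
    ∑ μ : Fin (d + 1) → κ, (∏ k, w k (μ k)) * F μ
      = ∑ i, w 0 i * ∑ μ : Fin d → κ, (∏ k, w k.succ (μ k)) * F (Fin.cons i μ) := by
  rw [← (Fin.consEquiv fun _ : Fin (d + 1) => κ).sum_comp, Fintype.sum_prod_type]
  simp only [Fin.consEquiv_apply, Fin.prod_univ_succ, Fin.cons_zero, Fin.cons_succ,
    Finset.mul_sum, mul_assoc]
  rfl

/-- Replacing the coordinates of `z` by nodes one after the other, each new coordinate contributes
`ε` times the product of the Lebesgue constants of the coordinates before it. -/
lemma abs_sub_sum_prod_mul_le {α κ : Type*} [Fintype κ] {d : ℕ} {A : Fin d → Set α}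
    {ξ : Fin d → κ → α} (hξ : ∀ k i, ξ k i ∈ A k) {w : Fin d → κ → ℝ} {Λ : ℝ}
    (hw : ∀ k, ∑ i, |w k i| ≤ Λ) {z : Fin d → α} (hz : ∀ k, z k ∈ A k)
    {f : (Fin d → α) → ℝ} {ε : ℝ}
    (hf : ∀ k u, (∀ j, u j ∈ A j) → u k = z k →
      |f u - ∑ i, w k i * f (Function.update u k (ξ k i))| ≤ ε) :
    |f z - ∑ μ : Fin d → κ, (∏ k, w k (μ k)) * f (fun k => ξ k (μ k))|
      ≤ (∑ k ∈ Finset.range d, Λ ^ k) * ε := by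
  induction d with
  | zero =>
    have hz0 : ∀ μ : Fin 0 → κ, (fun k => ξ k (μ k)) = z := fun μ => Subsingleton.elim _ _
    simp [hz0]
  | succ d ih =>
    have hfirst := hf 0 z hz rfl
    have hε : 0 ≤ ε := (abs_nonneg _).trans hfirst
    have hΛ : 0 ≤ Λ := (Finset.sum_nonneg fun _ _ => abs_nonneg _).trans (hw 0)
    have hupdate : ∀ i, Function.update z 0 (ξ 0 i) = Fin.cons (ξ 0 i) (Fin.tail z) := fun i => by
      rw [← Fin.update_cons_zero (z 0) (Fin.tail z), Fin.cons_self_tail]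
    simp only [hupdate] at hfirst
    have hnode : ∀ i (μ : Fin d → κ), (fun k => ξ k ((Fin.cons i μ : Fin (d + 1) → κ) k))
        = Fin.cons (ξ 0 i) (fun k => ξ k.succ (μ k)) := fun i μ => by
      funext k
      cases k using Fin.cases <;> rfl
    have hrest : ∀ i, |f (Fin.cons (ξ 0 i) (Fin.tail z))
        - ∑ μ : Fin d → κ, (∏ k, w k.succ (μ k)) *
            f (Fin.cons (ξ 0 i) (fun k => ξ k.succ (μ k)))|
          ≤ (∑ k ∈ Finset.range d, Λ ^ k) * ε := fun i => by
      refine ih (f := fun u => f (Fin.cons (ξ 0 i) u)) (fun k => hξ k.succ) (fun k => hw k.succ)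
        (fun k => hz k.succ) fun k u hu huz => ?_
      simp only [Fin.cons_update]
      exact hf k.succ _ (Fin.cases (hξ 0 i) hu) huz
    rw [sum_prod_mul_eq_sum_mul_sum_cons w fun μ => f fun k => ξ k (μ k)]
    simp only [hnode]
    refine (abs_sub_sum_mul_le (by positivity) hfirst hrest (hw 0)).trans_eq ?_
    rw [geom_sum_succ]
    ring

lemma sum_abs_tensorLagrange_le {n : ℕ} {Λ : ℝ} {ξ : Fin 3 → Fin (n + 1) → ℝ} {x : Fin 3 → ℝ}
    (h : ∀ k, ∑ i, |lagrange (ξ k) i (x k)| ≤ Λ) : ∑ μ, |tensorLagrange ξ μ x| ≤ Λ ^ 3 :=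
  calc ∑ μ, |tensorLagrange ξ μ x| = ∏ k, ∑ i, |lagrange (ξ k) i (x k)| := by
        rw [Finset.prod_univ_sum, Fintype.piFinset_univ]
        simp only [tensorLagrange, Finset.abs_prod]
    _ ≤ ∏ _k : Fin 3, Λ :=
        Finset.prod_le_prod (fun k _ => Finset.sum_nonneg fun i _ => abs_nonneg _) fun k _ => h k
    _ = Λ ^ 3 := by simp

variable {n : ℕ} {Λ ε : ℝ} {a b a₁ b₁ a₂ b₂ : Fin 3 → ℝ} {ξ ξ₁ ξ₂ : Fin 3 → Fin (n + 1) → ℝ}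

lemma IsInterpolationGrid.node_mem (hξ : IsInterpolationGrid Λ (Set.Icc a b) ξ) (k : Fin 3)
    (i : Fin (n + 1)) : ξ k i ∈ Set.Icc (a k) (b k) :=
  ⟨(hξ.mem fun _ => i).1 k, (hξ.mem fun _ => i).2 k⟩

lemma IsInterpolationGrid.nonneg {Q : Set (Fin 3 → ℝ)} (hξ : IsInterpolationGrid Λ Q ξ) :
    0 ≤ Λ :=
  (Finset.sum_nonneg fun _ _ => abs_nonneg _).trans (hξ.lebesgue_le 0 _ (hξ.mem 0))

/-- `f` is approximable within `ε` along every segment of the box `[a, b]` parallel to an axis. -/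
def PolynomiallyApproximableAlongAxes (f : (Fin 3 → ℝ) → ℝ) (a b : Fin 3 → ℝ) (m : ℕ) (ε : ℝ) :
    Prop :=
  ∀ x ∈ Set.Icc a b, ∀ k,
    PolynomiallyApproximable (fun t => f (Function.update x k t)) (Set.Icc (a k) (b k)) m ε

lemma IsInterpolationGrid.abs_sub_sum_tensorLagrange_le
    (hξ : IsInterpolationGrid Λ (Set.Icc a b) ξ) {f : (Fin 3 → ℝ) → ℝ}
    (hf : PolynomiallyApproximableAlongAxes f a b (n + 1) ε) {x : Fin 3 → ℝ}
    (hx : x ∈ Set.Icc a b) :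
    |f x - ∑ μ, tensorLagrange ξ μ x * f (gridPoint ξ μ)|
      ≤ (∑ k ∈ Finset.range 3, Λ ^ k) * ((1 + Λ) * ε) := by
  refine abs_sub_sum_prod_mul_le (A := fun k => Set.Icc (a k) (b k)) hξ.node_mem
    (fun k => hξ.lebesgue_le k x hx) (fun k => ⟨hx.1 k, hx.2 k⟩) fun k u hu hux => ?_
  have huQ : u ∈ Set.Icc a b := ⟨fun j => (hu j).1, fun j => (hu j).2⟩
  have hslice := (hf u huQ k).abs_sub_sum_lagrange_le (hξ.injective k) (hξ.node_mem k) (hu k)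
    (hξ.lebesgue_le k u huQ)
  rwa [Function.update_eq_self, hux] at hslice

lemma norm_sub_interpolant_le (hξ₁ : IsInterpolationGrid Λ (Set.Icc a₁ b₁) ξ₁)
    (hξ₂ : IsInterpolationGrid Λ (Set.Icc a₂ b₂) ξ₂) {G : (Fin 3 → ℝ) → (Fin 3 → ℝ) → Fin 3 → ℝ}
    (hG₁ : ∀ y ∈ Set.Icc a₂ b₂, ∀ c,
      PolynomiallyApproximableAlongAxes (fun x => G x y c) a₁ b₁ (n + 1) ε)
    (hG₂ : ∀ x ∈ Set.Icc a₁ b₁, ∀ c,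
      PolynomiallyApproximableAlongAxes (fun y => G x y c) a₂ b₂ (n + 1) ε)
    {x y : Fin 3 → ℝ} (hx : x ∈ Set.Icc a₁ b₁) (hy : y ∈ Set.Icc a₂ b₂) :
    ‖G x y - interpolant ξ₁ ξ₂ G x y‖
      ≤ (1 + Λ ^ 3) * ((∑ k ∈ Finset.range 3, Λ ^ k) * ((1 + Λ) * ε)) := by
  set E := (∑ k ∈ Finset.range 3, Λ ^ k) * ((1 + Λ) * ε)
  have hxerr : ∀ c,
      |G x y c - ∑ μ, tensorLagrange ξ₁ μ x * G (gridPoint ξ₁ μ) y c| ≤ E := fun c =>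
    hξ₁.abs_sub_sum_tensorLagrange_le (hG₁ y hy c) hx
  have hyerr : ∀ c μ, |G (gridPoint ξ₁ μ) y c
      - ∑ ν, tensorLagrange ξ₂ ν y * G (gridPoint ξ₁ μ) (gridPoint ξ₂ ν) c| ≤ E := fun c μ =>
    hξ₂.abs_sub_sum_tensorLagrange_le (hG₂ _ (hξ₁.mem μ) c) hy
  have hE : 0 ≤ E := (abs_nonneg _).trans (hxerr 0)
  have hΛ : 0 ≤ Λ := hξ₁.nonneg
  refine (pi_norm_le_iff_of_nonneg (by positivity)).2 fun c => ?_
  have hsum := abs_sub_sum_mul_le hE (hxerr c) (hyerr c)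
    (sum_abs_tensorLagrange_le fun k => hξ₁.lebesgue_le k x hx)
  rw [one_add_mul]
  simpa only [Real.norm_eq_abs, interpolant, Pi.sub_apply, Finset.sum_apply, Pi.smul_apply,
    smul_eq_mul, Finset.mul_sum, mul_assoc] using hsum

end Interpolation

section EuclideanGeometry

lemma sq_dist_le_or_sq_dist_le_of_mem_segment {E : Type*} [NormedAddCommGroup E]
    [InnerProductSpace ℝ E] {p q m : E} (hm : m ∈ segment ℝ p q) (x : E) :
    dist x p ^ 2 ≤ dist x m ^ 2 + dist p q ^ 2 / 4 ∨
      dist x q ^ 2 ≤ dist x m ^ 2 + dist p q ^ 2 / 4 := by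
  obtain ⟨a, b, ha, hb, hab, rfl⟩ := hm
  have hstewart : a * dist x p ^ 2 + b * dist x q ^ 2
      = dist x (a • p + b • q) ^ 2 + a * b * dist p q ^ 2 := by
    have hx : x - (a • p + b • q) = a • (x - p) + b • (x - q) := by
      rw [smul_sub, smul_sub, sub_add_sub_comm, ← add_smul, hab, one_smul]
    have hpq : p - q = (x - q) - (x - p) := by abel
    rw [dist_eq_norm, dist_eq_norm, dist_eq_norm, dist_eq_norm, hx, hpq, norm_add_sq_real,
      norm_sub_sq_real (x - q), norm_smul, norm_smul, inner_smul_left, inner_smul_right,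
      real_inner_comm (x - p), mul_pow, mul_pow, Real.norm_eq_abs, Real.norm_eq_abs, sq_abs, sq_abs]
    obtain rfl : b = 1 - a := by linarith
    simp only [RCLike.conj_to_real]
    ring
  have hquarter : a * b ≤ 1 / 4 := by nlinarith [sq_nonneg (a - b)]
  refine min_le_iff.1 ((Convex.min_le_combo _ _ ha hb hab).trans ?_)
  rw [smul_eq_mul, smul_eq_mul, hstewart]
  linarith [mul_le_mul_of_nonneg_right hquarter (sq_nonneg (dist p q))]

variable {ι : Type*} [Fintype ι]

lemma sq_apply_sub_add_sq_apply_sub_le_sq_dist {u v : EuclideanSpace ℝ ι} {j k : ι} (hjk : j ≠ k) :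
    (u j - v j) ^ 2 + (u k - v k) ^ 2 ≤ dist u v ^ 2 := by
  classical
  rw [EuclideanSpace.dist_eq, Real.sq_sqrt (Finset.sum_nonneg fun _ _ => sq_nonneg _)]
  simp only [Real.dist_eq, sq_abs]
  rw [← Finset.sum_pair (f := fun i => (u i - v i) ^ 2) hjk]
  exact Finset.sum_le_univ_sum_of_nonneg fun _ => sq_nonneg _

/-- Summing `dist x (m k) ^ 2` over `k`, the square `(m j j - m k j) ^ 2` pairs up with
`(m k k - m j k) ^ 2`, and each pair is bounded by `dist (m j) (m k) ^ 2`. -/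
lemma exists_sq_dist_le_of_apply_eq [Nonempty ι] {m : ι → EuclideanSpace ℝ ι}
    {x : EuclideanSpace ℝ ι} {δ : ℝ} (hmx : ∀ k, m k k = x k) (hm : ∀ j k, dist (m j) (m k) ≤ δ) :
    ∃ k, dist x (m k) ^ 2 ≤ (Fintype.card ι - 1) / 2 * δ ^ 2 := by
  classical
  have hdist : ∀ k, dist x (m k) ^ 2 = ∑ j, (m j j - m k j) ^ 2 := fun k => by
    rw [EuclideanSpace.dist_eq, Real.sq_sqrt (Finset.sum_nonneg fun _ _ => sq_nonneg _)]
    simp only [Real.dist_eq, sq_abs, hmx]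
  have hpair : ∀ k j, (m j j - m k j) ^ 2 + (m k k - m j k) ^ 2 ≤ if k = j then 0 else δ ^ 2 :=
    fun k j => by
    split_ifs with hkj
    · simp [hkj]
    · rw [← neg_sub (m j k), neg_sq]
      exact (sq_apply_sub_add_sq_apply_sub_le_sq_dist (Ne.symm hkj)).trans (by gcongr; exact hm j k)
  have hsum : 2 * ∑ k, dist x (m k) ^ 2 ≤ Fintype.card ι * ((Fintype.card ι - 1) * δ ^ 2) :=
    calc 2 * ∑ k, dist x (m k) ^ 2
        = ∑ k, ∑ j, ((m j j - m k j) ^ 2 + (m k k - m j k) ^ 2) := by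
          simp only [Finset.sum_add_distrib, hdist, two_mul]
          rw [Finset.sum_comm (f := fun k j => (m k k - m j k) ^ 2)]
      _ ≤ ∑ k, ∑ j, if k = j then 0 else δ ^ 2 :=
          Finset.sum_le_sum fun k _ => Finset.sum_le_sum fun j _ => hpair k j
      _ = Fintype.card ι * ((Fintype.card ι - 1) * δ ^ 2) := by
          simp [Finset.sum_ite, Finset.filter_ne, Finset.card_erase_of_mem, Finset.card_univ,
            Nat.cast_sub Fintype.card_pos]
  obtain ⟨k, -, hk⟩ := Finset.exists_le_of_sum_le (s := Finset.univ)
    (f := fun k => dist x (m k) ^ 2) (g := fun _ => (Fintype.card ι - 1) / 2 * δ ^ 2)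
    Finset.univ_nonempty (by
      rw [Finset.sum_const, Finset.card_univ, nsmul_eq_mul]
      linarith)
  exact ⟨k, hk⟩

lemma exists_sq_dist_le_of_apply_mem_segment [Nonempty ι] {S : Set (EuclideanSpace ℝ ι)} {δ : ℝ}
    (hS : ∀ p ∈ S, ∀ q ∈ S, dist p q ≤ δ) {x : EuclideanSpace ℝ ι}
    (hx : ∀ k, ∃ p ∈ S, ∃ q ∈ S, x k ∈ segment ℝ (p k) (q k)) :
    ∃ z ∈ S, dist x z ^ 2 ≤ (2 * Fintype.card ι - 1) / 4 * δ ^ 2 := by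
  choose p hp q hq hx using hx
  have hm : ∀ k, ∃ m ∈ segment ℝ (p k) (q k), m k = x k := fun k => by
    have himage := image_segment ℝ (EuclideanSpace.projₗ k).toAffineMap (p k) (q k)
    exact himage.ge (hx k)
  choose m hm hmx using hm
  have hmS : ∀ j k, dist (m j) (m k) ≤ δ := fun j k => by
    obtain ⟨u, hu, v, hv, huv⟩ := convexHull_exists_dist_ge2
      (segment_subset_convexHull (hp j) (hq j) (hm j))
      (segment_subset_convexHull (hp k) (hq k) (hm k))
    exact huv.trans (hS u hu v hv)
  obtain ⟨k, hk⟩ := exists_sq_dist_le_of_apply_eq hmx hmS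
  have hpq : dist (p k) (q k) ^ 2 ≤ δ ^ 2 := by
    gcongr
    exact hS _ (hp k) _ (hq k)
  rcases sq_dist_le_or_sq_dist_le_of_mem_segment (hm k) x with h | h
  · exact ⟨p k, hp k, by linarith⟩
  · exact ⟨q k, hq k, by linarith⟩

end EuclideanGeometry

section StretchedDistance

variable {s x y : Fin 3 → ℝ} {S T : Set (Fin 3 → ℝ)} {δ : ℝ}

lemma stretchedNorm_eq_dist (s x y : Fin 3 → ℝ) :
    stretchedNorm s x y = dist (WithLp.toLp 2 (s * x)) (WithLp.toLp 2 (s * y)) := by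
  rw [dist_eq_norm, ← WithLp.toLp_sub, ← mul_sub]
  rfl

lemma stretchedNorm_nonneg (s x y : Fin 3 → ℝ) : 0 ≤ stretchedNorm s x y := norm_nonneg _

lemma stretchedNorm_comm (s x y : Fin 3 → ℝ) : stretchedNorm s x y = stretchedNorm s y x := by
  simp only [stretchedNorm_eq_dist, dist_comm]

lemma stretchedNorm_sq (s x y : Fin 3 → ℝ) :
    stretchedNorm s x y ^ 2 = ∑ k, (s k * (x k - y k)) ^ 2 := by
  simp only [stretchedNorm, EuclideanSpace.norm_sq_eq, Real.norm_eq_abs, sq_abs]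

lemma abs_mul_sub_le_stretchedNorm (s x y : Fin 3 → ℝ) (k : Fin 3) :
    |s k * (x k - y k)| ≤ stretchedNorm s x y :=
  PiLp.norm_apply_le (WithLp.toLp 2 fun k => s k * (x k - y k)) k

lemma stretchedNorm_le_stretchedDiam (hS : IsCompact S) (hx : x ∈ S) (hy : y ∈ S) :
    stretchedNorm s x y ≤ stretchedDiam s S := by
  have hcont : Continuous fun z : (Fin 3 → ℝ) × (Fin 3 → ℝ) => stretchedNorm s z.1 z.2 := by
    unfold stretchedNorm
    fun_prop
  refine le_csSup (((hS.prod hS).image hcont).bddAbove.mono ?_) ⟨x, hx, y, hy, rfl⟩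
  rintro _ ⟨x, hx, y, hy, rfl⟩
  exact ⟨(x, y), ⟨hx, hy⟩, rfl⟩

lemma stretchedDiam_nonneg (s : Fin 3 → ℝ) (S : Set (Fin 3 → ℝ)) : 0 ≤ stretchedDiam s S := by
  refine Real.sSup_nonneg ?_
  rintro _ ⟨x, -, y, -, rfl⟩
  exact stretchedNorm_nonneg s x y

lemma stretchedDist_le_stretchedNorm (hx : x ∈ S) (hy : y ∈ T) :
    stretchedDist s S T ≤ stretchedNorm s x y := by
  refine csInf_le ⟨0, ?_⟩ ⟨x, hx, y, hy, rfl⟩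
  rintro _ ⟨x, -, y, -, rfl⟩
  exact stretchedNorm_nonneg s x y

lemma mul_sSup_sub_sInf_le_stretchedDiam (hS : IsCompact S) (hne : S.Nonempty) (k : Fin 3) :
    s k * (sSup ((fun x : Fin 3 → ℝ => x k) '' S) - sInf ((fun x : Fin 3 → ℝ => x k) '' S))
      ≤ stretchedDiam s S := by
  obtain ⟨p, hp, hpk⟩ := hS.exists_sInf_image_eq hne (continuous_apply k).continuousOn
  obtain ⟨q, hq, hqk⟩ := hS.exists_sSup_image_eq hne (continuous_apply k).continuousOn
  rw [hpk, hqk]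
  exact (le_abs_self _).trans ((abs_mul_sub_le_stretchedNorm s q p k).trans
    (stretchedNorm_le_stretchedDiam hS hq hp))

lemma exists_stretchedNorm_le_of_mem_boundingBox (hS : IsCompact S) (hne : S.Nonempty)
    (hx : x ∈ boundingBox S) : ∃ z ∈ S, stretchedNorm s x z ≤ √5 / 2 * stretchedDiam s S := by
  have hdist : ∀ p ∈ (fun z => WithLp.toLp 2 (s * z)) '' S,
      ∀ q ∈ (fun z => WithLp.toLp 2 (s * z)) '' S, dist p q ≤ stretchedDiam s S := by
    rintro _ ⟨p, hp, rfl⟩ _ ⟨q, hq, rfl⟩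
    rw [← stretchedNorm_eq_dist]
    exact stretchedNorm_le_stretchedDiam hS hp hq
  obtain ⟨_, ⟨z, hz, rfl⟩, hxz⟩ := exists_sq_dist_le_of_apply_mem_segment hdist
    (x := WithLp.toLp 2 (s * x)) fun k => by
      obtain ⟨p, hp, hpk⟩ := hS.exists_sInf_image_eq hne (continuous_apply k).continuousOn
      obtain ⟨q, hq, hqk⟩ := hS.exists_sSup_image_eq hne (continuous_apply k).continuousOn
      have hxk : x k ∈ segment ℝ (p k) (q k) :=
        Icc_subset_segment ⟨hpk.ge.trans (hx.1 k), (hx.2 k).trans hqk.le⟩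
      refine ⟨_, ⟨p, hp, rfl⟩, _, ⟨q, hq, rfl⟩, ?_⟩
      exact (image_segment ℝ (LinearMap.mulLeft ℝ (s k)).toAffineMap (p k) (q k)).le ⟨x k, hxk, rfl⟩
  refine ⟨z, hz, le_of_sq_le_sq ?_ (mul_nonneg (by positivity) (stretchedDiam_nonneg s S))⟩
  rw [stretchedNorm_eq_dist, mul_pow, div_pow, Real.sq_sqrt (by norm_num)]
  refine hxz.trans_eq ?_
  norm_num

lemma mul_stretchedDist_le_stretchedNorm_of_mem_boundingBox (hS : IsCompact S) (hSne : S.Nonempty)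
    (hT : IsCompact T) (hTne : T.Nonempty) {η : ℝ}
    (hη : max (stretchedDiam s S) (stretchedDiam s T) ≤ η * stretchedDist s S T)
    (hx : x ∈ boundingBox S) (hy : y ∈ boundingBox T) :
    (1 - √5 * η) * stretchedDist s S T ≤ stretchedNorm s x y := by
  obtain ⟨p, hp, hxp⟩ := exists_stretchedNorm_le_of_mem_boundingBox (s := s) hS hSne hx
  obtain ⟨q, hq, hyq⟩ := exists_stretchedNorm_le_of_mem_boundingBox (s := s) hT hTne hy
  have hpq : stretchedNorm s p q
      ≤ stretchedNorm s x p + stretchedNorm s x y + stretchedNorm s y q := by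
    rw [stretchedNorm_comm s x p]
    simp only [stretchedNorm_eq_dist]
    exact dist_triangle4 _ _ _ _
  have hS' := mul_le_mul_of_nonneg_left ((le_max_left _ _).trans hη) (Real.sqrt_nonneg 5)
  have hT' := mul_le_mul_of_nonneg_left ((le_max_right _ _).trans hη) (Real.sqrt_nonneg 5)
  linarith [stretchedDist_le_stretchedNorm (s := s) hp hq]

end StretchedDistance

section Kernel

variable {γ δ D : ℝ} {a b x y : Fin 3 → ℝ}

lemma kernel_apply_eq (γ : ℝ) (x y : Fin 3 → ℝ) (c : Fin 3) :
    kernel γ x y c = (x c - y c) / stretchedNorm (stretch γ) x y ^ 3 := by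
  have hsq : (x 0 - y 0) ^ 2 + (x 1 - y 1) ^ 2 + γ ^ 2 * (x 2 - y 2) ^ 2
      = stretchedNorm (stretch γ) x y ^ 2 := by
    simp [stretchedNorm_sq, Fin.sum_univ_three, stretch, mul_pow]
  rw [kernel, hsq, ← Real.rpow_natCast_mul (stretchedNorm_nonneg _ _ _), ← Real.rpow_natCast _ 3]
  norm_num

lemma kernel_swap (γ : ℝ) (x y : Fin 3 → ℝ) (c : Fin 3) : kernel γ x y c = -kernel γ y x c := by
  rw [kernel_apply_eq, kernel_apply_eq, stretchedNorm_comm, ← neg_div, neg_sub]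

lemma one_le_stretch (hγ : 1 ≤ γ) (k : Fin 3) : 1 ≤ stretch γ k := by
  fin_cases k <;> simp [stretch, hγ]

lemma stretchedNorm_update (s x y : Fin 3 → ℝ) (k : Fin 3) (t : ℝ) :
    stretchedNorm s (Function.update x k t) y
      = √((s k * (t - y k)) ^ 2 + ∑ j ∈ Finset.univ.erase k, (s j * (x j - y j)) ^ 2) := by
  rw [← Real.sqrt_sq (stretchedNorm_nonneg s _ y), stretchedNorm_sq,
    ← Finset.add_sum_erase _ _ (Finset.mem_univ k), Function.update_self]
  congr 2
  refine Finset.sum_congr rfl fun j hj => ?_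
  rw [Function.update_of_ne (Finset.ne_of_mem_erase hj)]

lemma exists_kernel_update_eq_radialQuotient (hγ : 1 ≤ γ) (x y : Fin 3 → ℝ) (k c : Fin 3) :
    ∃ A i j, i + j = 1 ∧ A ^ 2 ≤ ∑ l ∈ Finset.univ.erase k, (stretch γ l * (x l - y l)) ^ 2 ∧
      ∀ t, kernel γ (Function.update x k t) y c = (stretch γ c)⁻¹ *
        radialQuotient A (∑ l ∈ Finset.univ.erase k, (stretch γ l * (x l - y l)) ^ 2) i j 2
          (stretch γ k * (t - y k)) := by
  have hc : stretch γ c ≠ 0 := (one_pos.trans_le (one_le_stretch hγ c)).ne'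
  simp only [kernel_apply_eq, stretchedNorm_update, radialQuotient]
  by_cases hck : c = k
  · subst hck
    refine ⟨0, 1, 0, rfl, ?_, fun t => ?_⟩
    · rw [zero_pow two_ne_zero]
      positivity
    · rw [Function.update_self, pow_one, pow_zero, mul_one, mul_div_assoc, inv_mul_cancel_left₀ hc]
  · refine ⟨stretch γ c * (x c - y c), 0, 1, rfl, ?_, fun t => ?_⟩
    · exact Finset.single_le_sum (f := fun l => (stretch γ l * (x l - y l)) ^ 2)
        (fun _ _ => sq_nonneg _) (Finset.mem_erase.2 ⟨hck, Finset.mem_univ c⟩)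
    · rw [Function.update_of_ne hck, pow_zero, pow_one, one_mul, mul_div_assoc,
        inv_mul_cancel_left₀ hc]

lemma update_mem_Icc {ι α : Type*} [DecidableEq ι] [Preorder α] {a b x : ι → α}
    (hx : x ∈ Set.Icc a b) {k : ι} {t : α} (ht : t ∈ Set.Icc (a k) (b k)) :
    Function.update x k t ∈ Set.Icc a b :=
  ⟨le_update_iff.2 ⟨ht.1, fun j _ => hx.1 j⟩, update_le_iff.2 ⟨ht.2, fun j _ => hx.2 j⟩⟩

lemma polynomiallyApproximableAlongAxes_kernel (hγ : 1 ≤ γ) (hD : 0 < D)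
    (hab : ∀ k, stretch γ k * (b k - a k) ≤ δ)
    (hsep : ∀ x ∈ Set.Icc a b, D ≤ stretchedNorm (stretch γ) x y) (c : Fin 3) (m : ℕ) :
    PolynomiallyApproximableAlongAxes (fun x => kernel γ x y c) a b m
      ((3 * m + 4 : ℕ) ^ m * δ ^ m / D ^ (2 + m)) := by
  intro x hx k
  obtain ⟨A, i, j, hij, hA, hkernel⟩ := exists_kernel_update_eq_radialQuotient hγ x y k c
  have hs : ∀ l, 0 ≤ stretch γ l := fun l => zero_le_one.trans (one_le_stretch hγ l)
  have hinv : |(stretch γ c)⁻¹| ≤ 1 := by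
    rw [abs_of_nonneg (inv_nonneg.2 (hs c))]
    exact inv_le_one_of_one_le₀ (one_le_stretch hγ c)
  have hδ : 0 ≤ δ := (mul_nonneg (hs k) (sub_nonneg.2 ((hx.1 k).trans (hx.2 k)))).trans (hab k)
  set I := (fun t => stretch γ k * (t - y k)) '' Set.Icc (a k) (b k)
  have hI : Convex ℝ I :=
    (isPreconnected_Icc.image _ (by fun_prop)).ordConnected.convex
  have hak : stretch γ k * (a k - y k) ∈ I :=
    Set.mem_image_of_mem _ (Set.left_mem_Icc.2 ((hx.1 k).trans (hx.2 k)))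
  have hW : ∀ τ ∈ I, |τ - stretch γ k * (a k - y k)| ≤ δ := by
    rintro _ ⟨t, ht, rfl⟩
    rw [← mul_sub, sub_sub_sub_cancel_right,
      abs_of_nonneg (mul_nonneg (hs k) (sub_nonneg.2 ht.1))]
    exact (mul_le_mul_of_nonneg_left (sub_le_sub_right ht.2 _) (hs k)).trans (hab k)
  have hr : ∀ τ ∈ I,
      D ≤ √(τ ^ 2 + ∑ l ∈ Finset.univ.erase k, (stretch γ l * (x l - y l)) ^ 2) := by
    rintro _ ⟨t, ht, rfl⟩
    rw [← stretchedNorm_update]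
    exact hsep _ (update_mem_Icc hx ht)
  have hradial := polynomiallyApproximable_radialQuotient hA hI hak hW hD hr
    (show 2 * i + j + 2 + 3 * m ≤ 3 * m + 4 by omega)
  have haffine : ∀ t, stretch γ k * (t - y k) = stretch γ k * t + -(stretch γ k * y k) :=
    fun t => by ring
  simp only [hkernel, haffine]
  exact ((hradial.comp_affine (stretch γ k) (-(stretch γ k * y k)) fun t ht =>
    ⟨t, ht, haffine t⟩).const_mul _).mono (mul_le_of_le_one_left (by positivity) hinv)

/-- The constant of the interpolation error estimate between boxes at positive distance. The
absolute value only serves to make it positive for every real `Λ`; a Lebesgue constant is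
nonnegative. -/
def interpolationConstant (n : ℕ) (Λ : ℝ) : ℝ :=
  (1 + |Λ| ^ 3) * ((∑ k ∈ Finset.range 3, |Λ| ^ k) * ((1 + |Λ|) * (3 * (n + 1) + 4 : ℕ) ^ (n + 1)))

lemma interpolationConstant_pos (n : ℕ) (Λ : ℝ) : 0 < interpolationConstant n Λ := by
  have hgeom : 0 < ∑ k ∈ Finset.range 3, |Λ| ^ k := geom_sum_pos (abs_nonneg Λ) three_ne_zero
  unfold interpolationConstant
  positivity

lemma norm_kernel_sub_interpolant_Icc_le {n : ℕ} {Λ : ℝ} {a₁ b₁ a₂ b₂ : Fin 3 → ℝ}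
    {ξ₁ ξ₂ : Fin 3 → Fin (n + 1) → ℝ} (hγ : 1 ≤ γ)
    (hξ₁ : IsInterpolationGrid Λ (Set.Icc a₁ b₁) ξ₁)
    (hξ₂ : IsInterpolationGrid Λ (Set.Icc a₂ b₂) ξ₂)
    (h₁ : ∀ k, stretch γ k * (b₁ k - a₁ k) ≤ δ) (h₂ : ∀ k, stretch γ k * (b₂ k - a₂ k) ≤ δ)
    (hD : 0 < D)
    (hsep : ∀ x ∈ Set.Icc a₁ b₁, ∀ y ∈ Set.Icc a₂ b₂, D ≤ stretchedNorm (stretch γ) x y)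
    (hx : x ∈ Set.Icc a₁ b₁) (hy : y ∈ Set.Icc a₂ b₂) :
    ‖kernel γ x y - interpolant ξ₁ ξ₂ (kernel γ) x y‖
      ≤ interpolationConstant n Λ / D ^ 2 * (δ / D) ^ (n + 1) := by
  refine (norm_sub_interpolant_le hξ₁ hξ₂
    (fun y hy c => polynomiallyApproximableAlongAxes_kernel hγ hD h₁ (hsep · · y hy) c (n + 1))
    (fun x hx c y hy k => ?_) hx hy).trans_eq ?_
  · have hswap := polynomiallyApproximableAlongAxes_kernel hγ hD h₂
      (fun y hy => (hsep x hx y hy).trans_eq (stretchedNorm_comm _ x y)) c (n + 1) y hy k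
    simpa only [kernel_swap γ x, neg_one_mul, abs_neg, abs_one, one_mul] using hswap.const_mul (-1)
  · rw [interpolationConstant, abs_of_nonneg hξ₁.nonneg, div_pow, pow_add D]
    field_simp

lemma norm_kernel_sub_interpolant_boundingBox_le {n : ℕ} {Λ : ℝ} {S T : Set (Fin 3 → ℝ)}
    {ξ₁ ξ₂ : Fin 3 → Fin (n + 1) → ℝ} (hγ : 1 ≤ γ) (hS : IsCompact S) (hSne : S.Nonempty)
    (hT : IsCompact T) (hTne : T.Nonempty) (hξ₁ : IsInterpolationGrid Λ (boundingBox S) ξ₁)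
    (hξ₂ : IsInterpolationGrid Λ (boundingBox T) ξ₂) (hD : 0 < D)
    (hsep : ∀ x ∈ boundingBox S, ∀ y ∈ boundingBox T, D ≤ stretchedNorm (stretch γ) x y)
    (hx : x ∈ boundingBox S) (hy : y ∈ boundingBox T) :
    ‖kernel γ x y - interpolant ξ₁ ξ₂ (kernel γ) x y‖
      ≤ interpolationConstant n Λ / D ^ 2 *
        (max (stretchedDiam (stretch γ) S) (stretchedDiam (stretch γ) T) / D) ^ (n + 1) :=
  norm_kernel_sub_interpolant_Icc_le hγ hξ₁ hξ₂
    (fun k => (mul_sSup_sub_sInf_le_stretchedDiam hS hSne k).trans (le_max_left _ _))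
    (fun k => (mul_sSup_sub_sInf_le_stretchedDiam hT hTne k).trans (le_max_right _ _))
    hD hsep hx hy

lemma norm_kernel_sub_interpolant_boundingBox_le_of_admissible {n : ℕ} {Λ η : ℝ}
    {S T : Set (Fin 3 → ℝ)} {ξ₁ ξ₂ : Fin 3 → Fin (n + 1) → ℝ} (hγ : 1 ≤ γ) (hS : IsCompact S)
    (hSne : S.Nonempty) (hT : IsCompact T) (hTne : T.Nonempty)
    (hξ₁ : IsInterpolationGrid Λ (boundingBox S) ξ₁)
    (hξ₂ : IsInterpolationGrid Λ (boundingBox T) ξ₂) (hη : √5 * η < 1)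
    (hd : 0 < stretchedDist (stretch γ) S T)
    (hadm : max (stretchedDiam (stretch γ) S) (stretchedDiam (stretch γ) T)
      ≤ η * stretchedDist (stretch γ) S T)
    (hx : x ∈ boundingBox S) (hy : y ∈ boundingBox T) :
    ‖kernel γ x y - interpolant ξ₁ ξ₂ (kernel γ) x y‖
      ≤ interpolationConstant n Λ / (1 - √5 * η) ^ (n + 3) / stretchedDist (stretch γ) S T ^ 2 *
        (max (stretchedDiam (stretch γ) S) (stretchedDiam (stretch γ) T)
          / stretchedDist (stretch γ) S T) ^ (n + 1) := by
  have hη' : 0 < 1 - √5 * η := sub_pos.2 hη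
  refine (norm_kernel_sub_interpolant_boundingBox_le hγ hS hSne hT hTne hξ₁ hξ₂ (mul_pos hη' hd)
    (fun x hx y hy => mul_stretchedDist_le_stretchedNorm_of_mem_boundingBox hS hSne hT hTne hadm
      hx hy) hx hy).trans_eq ?_
  rw [show n + 3 = 2 + (n + 1) by ring, pow_add _ 2 (n + 1), mul_pow, div_pow, div_pow, mul_pow]
  field_simp

end Kernel

end RelativisticFMM

open RelativisticFMM in
theorem mainTheorem3_general (n : ℕ) (Λ : ℝ) :
    (∃ C : ℝ, 0 < C ∧
      ∀ (γ : ℝ), 1 ≤ γ → ∀ (St Ss : Set (Fin 3 → ℝ)),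
        IsCompact St → St.Nonempty → IsCompact Ss → Ss.Nonempty →
      ∀ (ξt ξs : Fin 3 → Fin (n + 1) → ℝ),
        IsInterpolationGrid Λ (boundingBox St) ξt → IsInterpolationGrid Λ (boundingBox Ss) ξs →
      ∀ (δ d : ℝ),
        δ = max (stretchedDiam (stretch γ) St) (stretchedDiam (stretch γ) Ss) →
        d = stretchedDist (stretch γ) (boundingBox St) (boundingBox Ss) →
        0 < d →
      ∀ x ∈ boundingBox St, ∀ y ∈ boundingBox Ss,
        ‖kernel γ x y - interpolant ξt ξs (kernel γ) x y‖ ≤ C / d ^ 2 * (δ / d) ^ (n + 1) ∧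
        ∀ η : ℝ, δ / d < η →
          ‖kernel γ x y - interpolant ξt ξs (kernel γ) x y‖ ≤ C / d ^ 2 * η ^ (n + 1)) ∧
    (∀ η : ℝ, √5 * η < 1 → ∃ C : ℝ, 0 < C ∧
      ∀ (γ : ℝ), 1 ≤ γ → ∀ (St Ss : Set (Fin 3 → ℝ)),
        IsCompact St → St.Nonempty → IsCompact Ss → Ss.Nonempty →
      ∀ (ξt ξs : Fin 3 → Fin (n + 1) → ℝ),
        IsInterpolationGrid Λ (boundingBox St) ξt → IsInterpolationGrid Λ (boundingBox Ss) ξs →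
      ∀ (δ d : ℝ),
        δ = max (stretchedDiam (stretch γ) St) (stretchedDiam (stretch γ) Ss) →
        d = stretchedDist (stretch γ) St Ss →
        0 < d → δ / d < η →
      ∀ x ∈ boundingBox St, ∀ y ∈ boundingBox Ss,
        ‖kernel γ x y - interpolant ξt ξs (kernel γ) x y‖ ≤ C / d ^ 2 * (δ / d) ^ (n + 1) ∧
        ‖kernel γ x y - interpolant ξt ξs (kernel γ) x y‖ ≤ C / d ^ 2 * η ^ (n + 1)) := by
  have hC := interpolationConstant_pos n Λ
  refine ⟨⟨interpolationConstant n Λ, hC, ?_⟩, fun η hη =>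
    ⟨interpolationConstant n Λ / (1 - √5 * η) ^ (n + 3), by have := sub_pos.2 hη; positivity, ?_⟩⟩
  · rintro γ hγ St Ss hSt hSt' hSs hSs' ξt ξs hξt hξs δ d rfl rfl hd x hx y hy
    have herr := norm_kernel_sub_interpolant_boundingBox_le hγ hSt hSt' hSs hSs' hξt hξs hd
      (fun _ hx _ hy => stretchedDist_le_stretchedNorm hx hy) hx hy
    have hratio := div_nonneg (le_max_of_le_left (c := stretchedDiam (stretch γ) Ss)
      (stretchedDiam_nonneg (stretch γ) St)) hd.le
    exact ⟨herr, fun η hη => herr.trans (by gcongr)⟩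
  · rintro γ hγ St Ss hSt hSt' hSs hSs' ξt ξs hξt hξs δ d rfl rfl hd hadm x hx y hy
    have herr := norm_kernel_sub_interpolant_boundingBox_le_of_admissible hγ hSt hSt' hSs hSs'
      hξt hξs hη hd ((div_lt_iff₀ hd).1 hadm).le hx hy
    have hratio := div_nonneg (le_max_of_le_left (c := stretchedDiam (stretch γ) Ss)
      (stretchedDiam_nonneg (stretch γ) St)) hd.le
    have := sub_pos.2 hη
    exact ⟨herr, herr.trans (by gcongr)⟩

theorem mainTheorem3 (n : ℕ) (Λ : ℝ) :
    -- distance between the bounding boxes, no restriction on the ratio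
    (∃ C : ℝ, 0 < C ∧
      ∀ (γ : ℝ), 1 ≤ γ → ∀ (St Ss : Set (Fin 3 → ℝ)),
        IsCompact St → St.Nonempty → IsCompact Ss → Ss.Nonempty →
      ∀ (ξt ξs : Fin 3 → Fin (n + 1) → ℝ),
        RelativisticFMM.IsInterpolationGrid Λ (RelativisticFMM.boundingBox St) ξt →
        RelativisticFMM.IsInterpolationGrid Λ (RelativisticFMM.boundingBox Ss) ξs →
      ∀ (δ d : ℝ),
        δ = max (RelativisticFMM.stretchedDiam (RelativisticFMM.stretch γ) St)
          (RelativisticFMM.stretchedDiam (RelativisticFMM.stretch γ) Ss) →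
        d = RelativisticFMM.stretchedDist (RelativisticFMM.stretch γ)
          (RelativisticFMM.boundingBox St) (RelativisticFMM.boundingBox Ss) →
        0 < d →
      ∀ x ∈ RelativisticFMM.boundingBox St, ∀ y ∈ RelativisticFMM.boundingBox Ss,
        ‖RelativisticFMM.kernel γ x y
            - RelativisticFMM.interpolant ξt ξs (RelativisticFMM.kernel γ) x y‖
          ≤ C / d ^ 2 * (δ / d) ^ (n + 1) ∧
        ∀ η : ℝ, 0 < η → δ / d < η →
          ‖RelativisticFMM.kernel γ x y
              - RelativisticFMM.interpolant ξt ξs (RelativisticFMM.kernel γ) x y‖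
            ≤ C / d ^ 2 * η ^ (n + 1)) ∧
    -- distance between the clusters themselves, under the admissibility condition
    (∀ η : ℝ, 0 < η → √6 * η < 1 → ∃ C : ℝ, 0 < C ∧
      ∀ (γ : ℝ), 1 ≤ γ → ∀ (St Ss : Set (Fin 3 → ℝ)),
        IsCompact St → St.Nonempty → IsCompact Ss → Ss.Nonempty →
      ∀ (ξt ξs : Fin 3 → Fin (n + 1) → ℝ),
        RelativisticFMM.IsInterpolationGrid Λ (RelativisticFMM.boundingBox St) ξt →
        RelativisticFMM.IsInterpolationGrid Λ (RelativisticFMM.boundingBox Ss) ξs →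
      ∀ (δ d : ℝ),
        δ = max (RelativisticFMM.stretchedDiam (RelativisticFMM.stretch γ) St)
          (RelativisticFMM.stretchedDiam (RelativisticFMM.stretch γ) Ss) →
        d = RelativisticFMM.stretchedDist (RelativisticFMM.stretch γ) St Ss →
        0 < d → δ / d < η →
      ∀ x ∈ RelativisticFMM.boundingBox St, ∀ y ∈ RelativisticFMM.boundingBox Ss,
        ‖RelativisticFMM.kernel γ x y
            - RelativisticFMM.interpolant ξt ξs (RelativisticFMM.kernel γ) x y‖
          ≤ C / d ^ 2 * (δ / d) ^ (n + 1) ∧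
        ‖RelativisticFMM.kernel γ x y
            - RelativisticFMM.interpolant ξt ξs (RelativisticFMM.kernel γ) x y‖
          ≤ C / d ^ 2 * η ^ (n + 1)) := by
  refine (mainTheorem3_general n Λ).imp (fun ⟨C, hC, h⟩ => ⟨C, hC, ?_⟩) fun h η hη hη6 =>
    h η (lt_of_le_of_lt (by gcongr; norm_num) hη6)
  grind
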